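/- All $C^*$-algebras are complex and unital, and $\mathfrak A\otimes\mathfrak A$ denotes the minimal (spatial) $C^*$-tensor product. A state preserving $C^*$-dynamical system $(\mathfrak A,\varphi,T)$ consists of a unital $C^*$-algebra $\mathfrak A$, a unital completely positive map $T:\mathfrak A\to\mathfrak A$ and a state $\varphi$ on $\mathfrak A$ with $\varphi\circ T=\varphi$. It is called uniquely ergodic if $\varphi$ is the only state $\omega$ on $\mathfrak A$ with $\omega\circ T=\omega$, and strictly weak mixing if $$\lim_{n\to\infty}\frac1n\sum_{k=0}^{n-1}\bigl|\psi(T^k(x))-\psi(\mathbf 1)\varphi(x)\bigr|=0\qquad\text{for all }x\in\mathfrak A,\ \psi\in\mathfrak A^*.$$ On $\mathfrak A\otimes\mathfrak A$ let $\varphi\otimes\varphi$ be the product state and $T\otimes T$ the unital completely positive map with $(T\otimes T)(x\otimes y)=T(x)\otimes T(y)$; then $(\mathfrak A\otimes\mathfrak A,\varphi\otimes\varphi,T\otimes T)$ is again a state preserving $C^*$-dynamical system. **Corollary.** Let $(\mathfrak A,\varphi,T)$ be a state preserving $C^*$-dynamical system. If $(\mathfrak A\otimes\mathfrak A,\varphi\otimes\varphi,T\otimes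 T)$ is uniquely ergodic, then $(\mathfrak A,\varphi,T)$ is strictly weak mixing. If, in addition, $(\mathfrak A\otimes\mathfrak A)^*=\mathfrak A^*\otimes\mathfrak A^*$, meaning that the linear span of the product functionals $f\otimes g$ with $f,g\in\mathfrak A^*$ is norm dense in $(\mathfrak A\otimes\mathfrak A)^*$, then the following three conditions are equivalent: 1. $(\mathfrak A\otimes\mathfrak A,\varphi\otimes\varphi,T\otimes T)$ is uniquely ergodic; 2. $(\mathfrak A,\varphi,T)$ is strictly weak mixing; 3. $(\mathfrak A\otimes\mathfrak A,\varphi\otimes\varphi,T\otimes T)$ is strictly weak mixing. -/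

import Mathlib

open scoped TensorProduct CStarAlgebra ComplexOrder InnerProductSpace

universe u v

noncomputable section

/-- A (unital) `*`-representation of a unital C⋆-algebra on a complex Hilbert space. -/
structure HilbertRep (A : Type u) [CStarAlgebra A] where
  carrier : Type u
  [normedAddCommGroup : NormedAddCommGroup carrier]
  [innerProductSpace : InnerProductSpace ℂ carrier]
  [completeSpace : CompleteSpace carrier]
  rep : A →⋆ₐ[ℂ] (carrier →L[ℂ] carrier)

attribute [instance] HilbertRep.normedAddCommGroup HilbertRep.innerProductSpace
  HilbertRep.completeSpace

namespace MinTensor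

open UniformSpace

section HilbertSpaces

variable (H K : Type*) [NormedAddCommGroup H] [InnerProductSpace ℂ H]
  [NormedAddCommGroup K] [InnerProductSpace ℂ K]

/-- The Hilbert space tensor product: the completion of the algebraic tensor product in the norm
of the inner product `⟪h ⊗ k, h' ⊗ k'⟫ = ⟪h, h'⟫ ⟪k, k'⟫`. -/
def HilbertTensor := Completion (H ⊗[ℂ] K)

instance : NormedAddCommGroup (HilbertTensor H K) :=
  inferInstanceAs (NormedAddCommGroup (Completion (H ⊗[ℂ] K)))
instance : InnerProductSpace ℂ (HilbertTensor H K) :=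
  inferInstanceAs (InnerProductSpace ℂ (Completion (H ⊗[ℂ] K)))
instance : CompleteSpace (HilbertTensor H K) :=
  inferInstanceAs (CompleteSpace (Completion (H ⊗[ℂ] K)))

variable {H K}

/-- The isometric embedding of the algebraic tensor product. -/
def toHilbert : H ⊗[ℂ] K →ₗᵢ[ℂ] HilbertTensor H K := Completion.toComplₗᵢ

/-- The elementary tensor `h ⊗ k` in the Hilbert space tensor product. -/
def vtmul (h : H) (k : K) : HilbertTensor H K := toHilbert (h ⊗ₜ k)

theorem inner_vtmul (h h' : H) (k k' : K) :
    ⟪vtmul h k, vtmul h' k'⟫_ℂ = ⟪h, h'⟫_ℂ * ⟪k, k'⟫_ℂ := by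
  rw [vtmul, vtmul, LinearIsometry.inner_map_map, TensorProduct.inner_tmul]

theorem toHilbert_induction {p : HilbertTensor H K → Prop} (x : HilbertTensor H K)
    (hp : IsClosed {x | p x}) (h : ∀ y, p (toHilbert y)) : p x :=
  Completion.induction_on x hp h

/-- Finite sums of elementary tensors are dense. -/
theorem vtmul_induction {p : HilbertTensor H K → Prop} (hp : IsClosed {x | p x})
    (h : ∀ (n : ℕ) (h : Fin n → H) (k : Fin n → K), p (∑ i, vtmul (h i) (k i)))
    (x : HilbertTensor H K) : p x := by
  induction x using toHilbert_induction with
  | hp => exact hp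
  | h y =>
    obtain ⟨S, rfl⟩ := TensorProduct.exists_finset y
    have := h _ (fun i => (S.equivFin.symm i).1.1) (fun i => (S.equivFin.symm i).1.2)
    rw [Equiv.sum_comp S.equivFin.symm (fun i => vtmul i.1.1 i.1.2),
      Finset.sum_coe_sort S (fun i => vtmul i.1 i.2)] at this
    rw [map_sum]
    exact this

/-- Two operators that agree on elementary tensors are equal. -/
theorem clm_ext {E : Type*} [NormedAddCommGroup E] [InnerProductSpace ℂ E]
    {f g : HilbertTensor H K →L[ℂ] E} (hfg : ∀ h k, f (vtmul h k) = g (vtmul h k)) : f = g := by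
  ext x
  induction x using vtmul_induction with
  | hp => exact isClosed_eq f.continuous g.continuous
  | h n h k => simp only [map_sum, hfg]

/-- The operator `S ⊗ T` on the Hilbert space tensor product. -/
def opTensor (S : H →L[ℂ] H) (T : K →L[ℂ] K) : HilbertTensor H K →L[ℂ] HilbertTensor H K :=
  (TensorProduct.mapL S T).completion

theorem opTensor_vtmul (S : H →L[ℂ] H) (T : K →L[ℂ] K) (h : H) (k : K) :
    opTensor S T (vtmul h k) = vtmul (S h) (T k) :=
  ContinuousLinearMap.completion_apply_coe _ _

theorem opTensor_toHilbert (S : H →L[ℂ] H) (T : K →L[ℂ] K) (x : H ⊗[ℂ] K) :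
    opTensor S T (toHilbert x) = toHilbert (TensorProduct.mapL S T x) :=
  ContinuousLinearMap.completion_apply_coe _ _

theorem norm_opTensor_le (S : H →L[ℂ] H) (T : K →L[ℂ] K) : ‖opTensor S T‖ ≤ ‖S‖ * ‖T‖ := by
  refine ContinuousLinearMap.opNorm_le_bound _ (by positivity) fun ξ => ?_
  induction ξ using toHilbert_induction with
  | hp => apply isClosed_le <;> fun_prop
  | h y =>
    rw [opTensor_toHilbert, LinearIsometry.norm_map, LinearIsometry.norm_map]
    exact ContinuousLinearMap.le_of_opNorm_le _ (TensorProduct.norm_mapL_le S T) y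

theorem vtmul_add_left (h h' : H) (k : K) : vtmul (h + h') k = vtmul h k + vtmul h' k := by
  rw [vtmul, TensorProduct.add_tmul, map_add]; rfl

theorem vtmul_add_right (h : H) (k k' : K) : vtmul h (k + k') = vtmul h k + vtmul h k' := by
  rw [vtmul, TensorProduct.tmul_add, map_add]; rfl

theorem vtmul_smul_left (c : ℂ) (h : H) (k : K) : vtmul (c • h) k = c • vtmul h k := by
  rw [vtmul, ← TensorProduct.smul_tmul', map_smul]; rfl

theorem vtmul_smul_right (c : ℂ) (h : H) (k : K) : vtmul h (c • k) = c • vtmul h k := by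
  rw [vtmul, TensorProduct.tmul_smul, map_smul]; rfl

end HilbertSpaces

section Rep

variable {A : Type u} {B : Type v} [CStarAlgebra A] [CStarAlgebra B]

theorem inner_rep_star (π : HilbertRep A) (a : A) (h h' : π.carrier) :
    ⟪π.rep (star a) h, h'⟫_ℂ = ⟪h, π.rep a h'⟫_ℂ := by
  rw [map_star, ContinuousLinearMap.star_eq_adjoint, ContinuousLinearMap.adjoint_inner_left]

/-- The underlying algebra homomorphism of `tensorRep`. -/
def tensorRepAlgHom (π : HilbertRep A) (ρ : HilbertRep B) :
    A ⊗[ℂ] B →ₐ[ℂ]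
      (HilbertTensor π.carrier ρ.carrier →L[ℂ] HilbertTensor π.carrier ρ.carrier) :=
  Algebra.TensorProduct.algHomOfLinearMapTensorProduct
    (TensorProduct.lift (LinearMap.mk₂ ℂ
      (fun a b => opTensor (π.rep a) (ρ.rep b))
      (fun a a' b => clm_ext fun h k => by
        simp [opTensor_vtmul, vtmul_add_left])
      (fun c a b => clm_ext fun h k => by
        simp [opTensor_vtmul, vtmul_smul_left])
      (fun a b b' => clm_ext fun h k => by
        simp [opTensor_vtmul, vtmul_add_right])
      (fun c a b => clm_ext fun h k => by
        simp [opTensor_vtmul, vtmul_smul_right])))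
    (fun a a' b b' => clm_ext fun h k => by simp [opTensor_vtmul])
    (clm_ext fun h k => by simp [opTensor_vtmul])

theorem tensorRepAlgHom_tmul (π : HilbertRep A) (ρ : HilbertRep B) (a : A) (b : B) :
    tensorRepAlgHom π ρ (a ⊗ₜ b) = opTensor (π.rep a) (ρ.rep b) := rfl

theorem star_opTensor (π : HilbertRep A) (ρ : HilbertRep B) (a : A) (b : B) :
    opTensor (π.rep (star a)) (ρ.rep (star b)) = star (opTensor (π.rep a) (ρ.rep b)) := by
  rw [ContinuousLinearMap.star_eq_adjoint, ContinuousLinearMap.eq_adjoint_iff]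
  intro ξ η
  induction ξ using vtmul_induction with
  | hp => apply isClosed_eq <;> fun_prop
  | h n h k =>
    induction η using vtmul_induction with
    | hp => apply isClosed_eq <;> fun_prop
    | h m h' k' =>
      simp only [map_sum, sum_inner, inner_sum, opTensor_vtmul, inner_vtmul, inner_rep_star]

/-- The representation `π ⊗ ρ` of the algebraic tensor product on the Hilbert space tensor
product, determined by `(π ⊗ ρ)(a ⊗ b) = π a ⊗ ρ b`. -/
def tensorRep (π : HilbertRep A) (ρ : HilbertRep B) :
    A ⊗[ℂ] B →⋆ₐ[ℂ]
      (HilbertTensor π.carrier ρ.carrier →L[ℂ] HilbertTensor π.carrier ρ.carrier) :=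
  { tensorRepAlgHom π ρ with
    map_star' := fun x => by
      change tensorRepAlgHom π ρ (star x) = star (tensorRepAlgHom π ρ x)
      induction x with
      | zero => simp
      | add x y hx hy => simp only [star_add, map_add, hx, hy]
      | tmul a b =>
        rw [TensorProduct.star_tmul, tensorRepAlgHom_tmul, tensorRepAlgHom_tmul, star_opTensor] }

theorem tensorRep_tmul (π : HilbertRep A) (ρ : HilbertRep B) (a : A) (b : B) :
    tensorRep π ρ (a ⊗ₜ b) = opTensor (π.rep a) (ρ.rep b) := rfl

theorem bddAbove_tensorRep (x : A ⊗[ℂ] B) :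
    BddAbove (Set.range fun p : HilbertRep A × HilbertRep B => ‖tensorRep p.1 p.2 x‖) := by
  induction x with
  | zero => exact ⟨0, by rintro _ ⟨p, rfl⟩; simp⟩
  | add x y hx hy =>
    obtain ⟨C, hC⟩ := hx
    obtain ⟨D, hD⟩ := hy
    refine ⟨C + D, ?_⟩
    rintro _ ⟨p, rfl⟩
    simp only [map_add]
    exact (norm_add_le _ _).trans (add_le_add (hC ⟨p, rfl⟩) (hD ⟨p, rfl⟩))
  | tmul a b =>
    refine ⟨‖a‖ * ‖b‖, ?_⟩
    rintro _ ⟨p, rfl⟩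
    simp only [tensorRep_tmul]
    grw [norm_opTensor_le, NonUnitalStarAlgHom.norm_apply_le,
      NonUnitalStarAlgHom.norm_apply_le]

/-- The minimal (spatial) C⋆-norm on the algebraic tensor product:
`‖x‖ = sup ‖(π ⊗ ρ)(x)‖` over all pairs of representations. -/
def minNorm (x : A ⊗[ℂ] B) : ℝ :=
  ⨆ p : HilbertRep A × HilbertRep B, ‖tensorRep p.1 p.2 x‖

theorem norm_tensorRep_le (π : HilbertRep A) (ρ : HilbertRep B) (x : A ⊗[ℂ] B) :
    ‖tensorRep π ρ x‖ ≤ minNorm x :=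
  le_ciSup (bddAbove_tensorRep x) (π, ρ)

theorem minNorm_nonneg (x : A ⊗[ℂ] B) : 0 ≤ minNorm x :=
  Real.iSup_nonneg fun _ => norm_nonneg _

theorem minNorm_le {x : A ⊗[ℂ] B} {C : ℝ} (hC : 0 ≤ C)
    (h : ∀ (π : HilbertRep A) (ρ : HilbertRep B), ‖tensorRep π ρ x‖ ≤ C) : minNorm x ≤ C :=
  Real.iSup_le (fun p => h p.1 p.2) hC

end Rep

/-- The algebraic tensor product, to be equipped with the minimal C⋆-norm. -/
def Pre (A : Type u) (B : Type v) [CStarAlgebra A] [CStarAlgebra B] : Type max u v := A ⊗[ℂ] B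

namespace Pre

variable {A : Type u} {B : Type v} [CStarAlgebra A] [CStarAlgebra B]

instance : Ring (Pre A B) := inferInstanceAs (Ring (A ⊗[ℂ] B))
instance : Algebra ℂ (Pre A B) := inferInstanceAs (Algebra ℂ (A ⊗[ℂ] B))
instance : StarRing (Pre A B) := inferInstanceAs (StarRing (A ⊗[ℂ] B))
instance : StarModule ℂ (Pre A B) := inferInstanceAs (StarModule ℂ (A ⊗[ℂ] B))

/-- The identity map from the algebraic tensor product. -/
def of : A ⊗[ℂ] B ≃⋆ₐ[ℂ] Pre A B := StarAlgEquiv.refl ℂ (A ⊗[ℂ] B)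

instance : SeminormedRing (Pre A B) :=
  RingSeminorm.toSeminormedRing
    { toFun := fun x => minNorm (of.symm x)
      map_zero' := le_antisymm (minNorm_le le_rfl fun π ρ => by simp) (minNorm_nonneg _)
      add_le' := fun x y => minNorm_le (add_nonneg (minNorm_nonneg _) (minNorm_nonneg _))
        fun π ρ => by
          rw [map_add, map_add]
          exact (norm_add_le _ _).trans
            (add_le_add (norm_tensorRep_le π ρ _) (norm_tensorRep_le π ρ _))
      neg' := fun x => by
        simp only [minNorm, map_neg, norm_neg]
      mul_le' := fun x y => minNorm_le (mul_nonneg (minNorm_nonneg _) (minNorm_nonneg _))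
        fun π ρ => by
          rw [map_mul, map_mul]
          exact (norm_mul_le _ _).trans
            (mul_le_mul (norm_tensorRep_le π ρ _) (norm_tensorRep_le π ρ _) (norm_nonneg _)
              (minNorm_nonneg _)) }

theorem norm_def (x : Pre A B) : ‖x‖ = minNorm (of.symm x) := rfl

instance : NormedAlgebra ℂ (Pre A B) where
  norm_smul_le c x := minNorm_le (mul_nonneg (norm_nonneg _) (minNorm_nonneg _)) fun π ρ => by
    rw [map_smul, map_smul, norm_smul]
    exact mul_le_mul_of_nonneg_left (norm_tensorRep_le π ρ _) (norm_nonneg _)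

theorem norm_star (x : Pre A B) : ‖star x‖ = ‖x‖ := by
  simp only [norm_def, minNorm, map_star, _root_.norm_star]

theorem norm_mul_self_le (x : Pre A B) : ‖x‖ * ‖x‖ ≤ ‖star x * x‖ := by
  rw [← sq, ← Real.le_sqrt (norm_nonneg _) (norm_nonneg _)]
  refine minNorm_le (Real.sqrt_nonneg _) fun π ρ => ?_
  rw [Real.le_sqrt (norm_nonneg _) (norm_nonneg _), sq, ← CStarRing.norm_star_mul_self,
    ← map_star, ← map_mul, ← map_star, ← map_mul]
  exact norm_tensorRep_le π ρ _

end Pre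

end MinTensor

/-- The minimal C⋆-tensor product `A ⊗ B` of two unital C⋆-algebras: the (Hausdorff) completion of
the algebraic tensor product in the minimal C⋆-norm. -/
def MinTensor (A : Type u) (B : Type v) [CStarAlgebra A] [CStarAlgebra B] : Type max u v :=
  UniformSpace.Completion (MinTensor.Pre A B)

namespace MinTensor

open UniformSpace

section Algebra

variable {A : Type u} {B : Type v} [CStarAlgebra A] [CStarAlgebra B]

instance : NormedRing (MinTensor A B) := inferInstanceAs (NormedRing (Completion (Pre A B)))
instance : CompleteSpace (MinTensor A B) := inferInstanceAs (CompleteSpace (Completion (Pre A B)))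
instance : Algebra ℂ (MinTensor A B) := inferInstanceAs (Algebra ℂ (Completion (Pre A B)))

/-- The canonical map of the algebraic tensor product into the minimal tensor product. -/
def ofPre (x : Pre A B) : MinTensor A B := (x : Completion (Pre A B))

theorem ofPre_add (x y : Pre A B) : ofPre (x + y) = ofPre x + ofPre y := Completion.coe_add x y
theorem ofPre_mul (x y : Pre A B) : ofPre (x * y) = ofPre x * ofPre y := Completion.coe_mul x y
theorem ofPre_smul (c : ℂ) (x : Pre A B) : ofPre (c • x) = c • ofPre x := Completion.coe_smul c x
theorem norm_ofPre (x : Pre A B) : ‖ofPre x‖ = ‖x‖ := Completion.norm_coe x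
theorem ofPre_one : ofPre (1 : Pre A B) = 1 := rfl
theorem continuous_ofPre : Continuous (ofPre : Pre A B → MinTensor A B) :=
  Completion.continuous_coe _
theorem denseRange_ofPre : DenseRange (ofPre : Pre A B → MinTensor A B) :=
  Completion.denseRange_coe

theorem induction_on {p : MinTensor A B → Prop} (x : MinTensor A B) (hp : IsClosed {x | p x})
    (h : ∀ x, p (ofPre x)) : p x := denseRange_ofPre.induction_on x hp h

theorem induction_on₂ {p : MinTensor A B → MinTensor A B → Prop} (x y : MinTensor A B)
    (hp : IsClosed {x : MinTensor A B × MinTensor A B | p x.1 x.2})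
    (h : ∀ x y, p (ofPre x) (ofPre y)) : p x y :=
  Completion.induction_on₂ x y hp h

instance : NormedAlgebra ℂ (MinTensor A B) :=
  { (inferInstance : Algebra ℂ (MinTensor A B)) with
    norm_smul_le := fun c x =>
      norm_smul_le (α := ℂ) (β := Completion (Pre A B)) c x }

theorem isometry_star : Isometry (star : Pre A B → Pre A B) :=
  AddMonoidHomClass.isometry_of_norm (starAddEquiv : Pre A B ≃+ Pre A B) Pre.norm_star

instance : Star (MinTensor A B) := ⟨Completion.map (star : Pre A B → Pre A B)⟩

theorem star_ofPre (x : Pre A B) : star (ofPre x) = ofPre (star x) :=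
  Completion.map_coe isometry_star.uniformContinuous x

instance : ContinuousStar (MinTensor A B) := ⟨Completion.continuous_map⟩

instance : StarRing (MinTensor A B) where
  star_involutive x := by
    induction x using induction_on with
    | hp => apply isClosed_eq <;> fun_prop
    | h x => simp only [star_ofPre, star_star]
  star_mul x y := by
    induction x, y using induction_on₂ with
    | hp => apply isClosed_eq <;> fun_prop
    | h x y => simp only [← ofPre_mul, star_ofPre, star_mul]
  star_add x y := by
    induction x, y using induction_on₂ with
    | hp => apply isClosed_eq <;> fun_prop
    | h x y => simp only [← ofPre_add, star_ofPre, star_add]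

instance : CStarAlgebra (MinTensor A B) where
  norm_mul_self_le x := by
    induction x using induction_on with
    | hp => apply isClosed_le <;> fun_prop
    | h x =>
      rw [star_ofPre, ← ofPre_mul, norm_ofPre, norm_ofPre]
      exact Pre.norm_mul_self_le x
  star_smul c x := by
    refine induction_on x (isClosed_eq (continuous_star.comp (continuous_const_smul c))
      ((continuous_const_smul (star c)).comp continuous_star)) fun y => ?_
    change star (c • ofPre y) = star c • star (ofPre y)
    rw [← ofPre_smul, star_ofPre, star_ofPre, ← ofPre_smul, star_smul]

/-- The canonical `*`-homomorphism of the algebraic tensor product into the minimal one. -/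
def emb : A ⊗[ℂ] B →⋆ₐ[ℂ] MinTensor A B where
  toFun x := ofPre (Pre.of x)
  map_one' := rfl
  map_mul' x y := ofPre_mul (Pre.of x) (Pre.of y)
  map_zero' := rfl
  map_add' x y := ofPre_add (Pre.of x) (Pre.of y)
  commutes' _ := rfl
  map_star' x := (star_ofPre (Pre.of x)).symm

/-- Elementary tensors `a ⊗ b` in the minimal tensor product. -/
def tmul (a : A) (b : B) : MinTensor A B := emb (a ⊗ₜ b)

theorem norm_emb (x : A ⊗[ℂ] B) : ‖(emb x : MinTensor A B)‖ = minNorm x :=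
  norm_ofPre (Pre.of x)

theorem denseRange_emb : DenseRange (emb : A ⊗[ℂ] B → MinTensor A B) := denseRange_ofPre

/-- The order of the minimal tensor product is its C⋆-algebra order. -/
instance : PartialOrder (MinTensor A B) := CStarAlgebra.spectralOrder _
instance : StarOrderedRing (MinTensor A B) := CStarAlgebra.spectralOrderedRing _

end Algebra

end MinTensor

namespace MinTensor

open UniformSpace

section GNS

/-- The GNS representation of a positive functional, as a Hilbert space representation. -/
theorem exists_gns {D : Type u} [CStarAlgebra D] [PartialOrder D] [StarOrderedRing D]
    (f : D →ₚ[ℂ] ℂ) : ∃ (π : HilbertRep D) (Λ : D → π.carrier),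
      ∀ a c b, ⟪Λ a, π.rep c (Λ b)⟫_ℂ = f (star a * c * b) := by
  refine ⟨⟨f.GNS, f.gnsStarAlgHom⟩, fun a => (f.toPreGNS a : f.GNS), fun a c b => ?_⟩
  change ⟪(f.toPreGNS a : f.GNS), f.gnsNonUnitalStarAlgHom c (f.toPreGNS b : f.GNS)⟫_ℂ = _
  rw [PositiveLinearMap.gnsNonUnitalStarAlgHom_apply_coe, Completion.inner_coe,
    PositiveLinearMap.preGNS_inner_def]
  simp [mul_assoc]

variable {A : Type u} [CStarAlgebra A]

theorem inner_rep_star' {A : Type u} [CStarAlgebra A] (π : HilbertRep A) (a : A)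
    (h h' : π.carrier) : ⟪h, π.rep (star a) h'⟫_ℂ = ⟪π.rep a h, h'⟫_ℂ := by
  rw [← inner_rep_star, star_star]

theorem exists_star_mul_self {D : Type*} [NonUnitalCStarAlgebra D] [PartialOrder D]
    [StarOrderedRing D] (a : D) (ha : 0 ≤ a) : ∃ b : D, a = star b * b :=
  CStarAlgebra.nonneg_iff_eq_star_mul_self.mp ha

theorem exists_factor [PartialOrder A] [StarOrderedRing A] {ι : Type*} [Fintype ι]
    (M : CStarMatrix ι ι A) (hM : 0 ≤ M) :
    ∃ N : ι → ι → A, ∀ p q, M p q = ∑ k, star (N k p) * N k q := by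
  obtain ⟨N, hN⟩ := exists_star_mul_self M hM
  refine ⟨N, fun p q => ?_⟩
  have := congrFun (congrFun hN p) q
  rw [CStarMatrix.mul_apply] at this
  exact this

/-- The amplification `a ↦ diag(a, …, a)`. -/
def amp (ι : Type) [Fintype ι] [DecidableEq ι] [PartialOrder A] [StarOrderedRing A] :
    A →⋆ₐ[ℂ] CStarMatrix ι ι A where
  toFun a := CStarMatrix.ofMatrix (Matrix.diagonal fun _ => a)
  map_one' := Matrix.diagonal_one
  map_mul' a b := (Matrix.diagonal_mul_diagonal (fun _ => a) (fun _ => b)).symm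
  map_zero' := Matrix.diagonal_zero
  map_add' a b := (Matrix.diagonal_add (fun _ => a) (fun _ => b)).symm
  commutes' c := by
    ext i j
    simp [CStarMatrix.algebraMap_apply, Matrix.diagonal_apply]
  map_star' a := (Matrix.diagonal_conjTranspose (fun _ => a)).symm

variable [PartialOrder A] [StarOrderedRing A]

/-- Positive functional on matrices attached to a completely positive map and vectors. -/
def dilationFunctional {ι : Type} [Fintype ι] (T : A →CP A) (π : HilbertRep A)
    (h : ι → π.carrier) : CStarMatrix ι ι A →ₚ[ℂ] ℂ :=
  PositiveLinearMap.mk₀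
    { toFun := fun M => ∑ p, ∑ q, ⟪h p, π.rep (T (M p q)) (h q)⟫_ℂ
      map_add' := fun M N => by
        simp [CStarMatrix.add_apply, map_add, Finset.sum_add_distrib]
      map_smul' := fun c M => by
        simp [CStarMatrix.smul_apply, map_smul, Finset.mul_sum] }
    (fun M hM => by
      obtain ⟨N, h2⟩ := exists_factor _ (T.map_cstarMatrix_nonneg M hM)
      simp only [CStarMatrix.map_apply] at h2
      change 0 ≤ ∑ p, ∑ q, ⟪h p, π.rep (T (M p q)) (h q)⟫_ℂ
      have h3 : ∑ p, ∑ q, ⟪h p, π.rep (T (M p q)) (h q)⟫_ℂ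
          = ∑ k, ⟪∑ p, π.rep (N k p) (h p), ∑ q, π.rep (N k q) (h q)⟫_ℂ := by
        simp only [h2, map_sum, map_mul, sum_apply, inner_sum, sum_inner,
          mul_apply_eq_comp, inner_rep_star']
        rw [Finset.sum_congr rfl fun p _ => Finset.sum_comm, Finset.sum_comm]
        exact Finset.sum_congr rfl fun k _ => Finset.sum_comm
      rw [h3]
      refine Finset.sum_nonneg fun k _ => ?_
      rw [inner_self_eq_norm_sq_to_K]
      positivity)

theorem exists_dilation {ι : Type} [Fintype ι] [DecidableEq ι] (T : A →CP A) (π : HilbertRep A)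
    (h : ι → π.carrier) : ∃ (π' : HilbertRep A) (h' : ι → π'.carrier),
      ∀ p q a, ⟪h' p, π'.rep a (h' q)⟫_ℂ = ⟪h p, π.rep (T a) (h q)⟫_ℂ := by
  rcases isEmpty_or_nonempty ι with hι | ⟨⟨r⟩⟩
  · exact ⟨π, isEmptyElim, fun p => isEmptyElim p⟩
  obtain ⟨σ, Λ, hσ⟩ := exists_gns (dilationFunctional T π h)
  refine ⟨⟨σ.carrier, σ.rep.comp (amp ι)⟩,
    fun p => Λ (CStarMatrix.ofMatrix (Matrix.single r p 1)), fun p q a => ?_⟩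
  change ⟪_, σ.rep (amp ι a) _⟫_ℂ = _
  rw [hσ]
  have : star (CStarMatrix.ofMatrix (Matrix.single r p (1 : A))) * amp ι a *
      CStarMatrix.ofMatrix (Matrix.single r q (1 : A)) =
      CStarMatrix.ofMatrix (Matrix.single p q a) := by
    change (Matrix.single r p (1 : A)).conjTranspose * (Matrix.diagonal (fun _ => a) : Matrix ι ι A) *
      Matrix.single r q (1 : A) = Matrix.single p q a
    rw [Matrix.conjTranspose_single]
    ext i j
    simp [Matrix.mul_apply, Matrix.single_apply, Matrix.diagonal_apply]
    by_cases h1 : p = i <;> by_cases h2 : q = j <;> simp [h1, h2]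
  rw [this]
  change ∑ i, ∑ j, ⟪h i, π.rep (T ((Matrix.single p q a : Matrix ι ι A) i j)) (h j)⟫_ℂ = _
  rw [Finset.sum_eq_single p, Finset.sum_eq_single q]
  · simp
  · intro j _ hj
    simp [hj.symm]
  · simp
  · intro j _ hj
    simp [hj.symm]
  · simp

end GNS

end MinTensor

namespace MinTensor

open UniformSpace

section Maps

variable {A : Type u} {B : Type v} [CStarAlgebra A] [CStarAlgebra B]

theorem exists_common {k : ℕ} (x : Fin k → A ⊗[ℂ] B) :
    ∃ (n : Fin k → ℕ) (a : (Σ i, Fin (n i)) → A) (b : (Σ i, Fin (n i)) → B),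
      ∀ i, x i = ∑ p, a ⟨i, p⟩ ⊗ₜ[ℂ] b ⟨i, p⟩ := by
  have h : ∀ y : A ⊗[ℂ] B, ∃ (n : ℕ) (a : Fin n → A) (b : Fin n → B),
      y = ∑ p, a p ⊗ₜ[ℂ] b p := fun y => by
    obtain ⟨S, rfl⟩ := TensorProduct.exists_finset y
    refine ⟨_, fun i => (S.equivFin.symm i).1.1, fun i => (S.equivFin.symm i).1.2, ?_⟩
    rw [Equiv.sum_comp S.equivFin.symm (fun i => i.1.1 ⊗ₜ[ℂ] i.1.2),
      Finset.sum_coe_sort S (fun i => i.1 ⊗ₜ[ℂ] i.2)]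
  choose n a b h using fun i => h (x i)
  exact ⟨n, fun p => a p.1 p.2, fun p => b p.1 p.2, h⟩

variable [PartialOrder A] [StarOrderedRing A] [PartialOrder B] [StarOrderedRing B]

/-- The algebraic tensor product of two maps: `a ⊗ b ↦ T a ⊗ S b`. -/
def algMap (T : A →CP A) (S : B →CP B) : A ⊗[ℂ] B →ₗ[ℂ] A ⊗[ℂ] B :=
  TensorProduct.map T.toLinearMap S.toLinearMap

theorem algMap_tmul (T : A →CP A) (S : B →CP B) (a : A) (b : B) :
    algMap T S (a ⊗ₜ b) = T a ⊗ₜ S b := rfl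

theorem algMap_one {T : A →CP A} {S : B →CP B} (hT : T 1 = 1) (hS : S 1 = 1) :
    algMap T S 1 = 1 := by
  rw [Algebra.TensorProduct.one_def, algMap_tmul, hT, hS]

theorem norm_inner_algMap_le {T : A →CP A} {S : B →CP B} (hT : T 1 = 1) (hS : S 1 = 1)
    (π : HilbertRep A) (ρ : HilbertRep B) (x : A ⊗[ℂ] B)
    (η ξ : HilbertTensor π.carrier ρ.carrier) :
    ‖⟪η, tensorRep π ρ (algMap T S x) ξ⟫_ℂ‖ ≤ minNorm x * ‖ξ‖ * ‖η‖ := by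
  induction η using vtmul_induction with
  | hp => apply isClosed_le <;> fun_prop
  | h m h₁ k₁ =>
  induction ξ using vtmul_induction with
  | hp => apply isClosed_le <;> fun_prop
  | h n h₂ k₂ =>
  obtain ⟨π', h', hπ⟩ := exists_dilation T π (Sum.elim h₁ h₂)
  obtain ⟨ρ', k', hρ⟩ := exists_dilation S ρ (Sum.elim k₁ k₂)
  have key : ∀ (y : A ⊗[ℂ] B) p q,
      ⟪vtmul (h' p) (k' p), tensorRep π' ρ' y (vtmul (h' q) (k' q))⟫_ℂ =
      ⟪vtmul (Sum.elim h₁ h₂ p) (Sum.elim k₁ k₂ p), tensorRep π ρ (algMap T S y)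
        (vtmul (Sum.elim h₁ h₂ q) (Sum.elim k₁ k₂ q))⟫_ℂ := by
    intro y p q
    induction y with
    | zero => simp
    | add y z hy hz => simp only [map_add, add_apply, inner_add_right, hy, hz]
    | tmul a b =>
      rw [algMap_tmul, tensorRep_tmul, tensorRep_tmul, opTensor_vtmul, opTensor_vtmul,
        inner_vtmul, inner_vtmul, hπ, hρ]
  have key1 : ∀ p q, ⟪vtmul (h' p) (k' p), vtmul (h' q) (k' q)⟫_ℂ =
      ⟪vtmul (Sum.elim h₁ h₂ p) (Sum.elim k₁ k₂ p),
        vtmul (Sum.elim h₁ h₂ q) (Sum.elim k₁ k₂ q)⟫_ℂ := by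
    intro p q
    have := key 1 p q
    rwa [algMap_one hT hS, map_one, map_one] at this
  have n1 : ‖∑ i, vtmul (h₁ i) (k₁ i)‖ = ‖∑ i, vtmul (h' (.inl i)) (k' (.inl i))‖ := by
    rw [norm_eq_sqrt_re_inner (𝕜 := ℂ), norm_eq_sqrt_re_inner (𝕜 := ℂ)]
    simp only [sum_inner, inner_sum, key1, Sum.elim_inl]
  have n2 : ‖∑ i, vtmul (h₂ i) (k₂ i)‖ = ‖∑ i, vtmul (h' (.inr i)) (k' (.inr i))‖ := by
    rw [norm_eq_sqrt_re_inner (𝕜 := ℂ), norm_eq_sqrt_re_inner (𝕜 := ℂ)]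
    simp only [sum_inner, inner_sum, key1, Sum.elim_inr]
  have n3 : ⟪∑ i, vtmul (h₁ i) (k₁ i), tensorRep π ρ (algMap T S x)
      (∑ i, vtmul (h₂ i) (k₂ i))⟫_ℂ =
      ⟪∑ i, vtmul (h' (.inl i)) (k' (.inl i)), tensorRep π' ρ' x
        (∑ i, vtmul (h' (.inr i)) (k' (.inr i)))⟫_ℂ := by
    simp only [map_sum, sum_inner, inner_sum, key, Sum.elim_inl, Sum.elim_inr]
  rw [n1, n2, n3]
  refine (norm_inner_le_norm _ _).trans ?_
  rw [mul_comm]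
  refine mul_le_mul_of_nonneg_right ?_ (norm_nonneg _)
  exact ContinuousLinearMap.le_of_opNorm_le _ (norm_tensorRep_le π' ρ' x) _

theorem minNorm_algMap_le {T : A →CP A} {S : B →CP B} (hT : T 1 = 1) (hS : S 1 = 1)
    (x : A ⊗[ℂ] B) : minNorm (algMap T S x) ≤ minNorm x := by
  refine minNorm_le (minNorm_nonneg _) fun π ρ => ?_
  refine ContinuousLinearMap.opNorm_le_bound _ (minNorm_nonneg _) fun ξ => ?_
  have h := norm_inner_algMap_le hT hS π ρ x (tensorRep π ρ (algMap T S x) ξ) ξ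
  rw [inner_self_eq_norm_sq_to_K] at h
  rcases (norm_nonneg (tensorRep π ρ (algMap T S x) ξ)).eq_or_lt with h0 | h0
  · rw [← h0]
    exact mul_nonneg (minNorm_nonneg _) (norm_nonneg _)
  · refine le_of_mul_le_mul_right (le_trans (le_of_eq ?_) h) h0
    simp [sq]

/-- `T ⊗ S` on the algebraic tensor product, as a contraction for the minimal norm. -/
def preMap (T : A →CP A) (S : B →CP B) (hT : T 1 = 1) (hS : S 1 = 1) : Pre A B →L[ℂ] Pre A B :=
  LinearMap.mkContinuous (algMap T S : A ⊗[ℂ] B →ₗ[ℂ] A ⊗[ℂ] B) 1 fun x => by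
    rw [one_mul]
    exact minNorm_algMap_le hT hS x

/-- `T ⊗ S` as a continuous map on the minimal tensor product. -/
def mapL (T : A →CP A) (S : B →CP B) (hT : T 1 = 1) (hS : S 1 = 1) :
    MinTensor A B →L[ℂ] MinTensor A B :=
  (preMap T S hT hS).completion

variable (T : A →CP A) (S : B →CP B) (hT : T 1 = 1) (hS : S 1 = 1)

theorem mapL_emb (x : A ⊗[ℂ] B) : mapL T S hT hS (emb x) = emb (algMap T S x) :=
  ContinuousLinearMap.completion_apply_coe _ _

/-- Gram matrices `(yᵢ* yⱼ)` are positive. -/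
theorem gram_nonneg {C : Type*} [CStarAlgebra C] [PartialOrder C] [StarOrderedRing C]
    {ι : Type*} [Fintype ι] (y : ι → C) :
    0 ≤ (CStarMatrix.ofMatrix (Matrix.of fun i j => star (y i) * y j) : CStarMatrix ι ι C) := by
  classical
  rcases isEmpty_or_nonempty ι with hk | ⟨⟨r⟩⟩
  · exact le_of_eq (CStarMatrix.ext fun i => isEmptyElim i)
  have : (CStarMatrix.ofMatrix (Matrix.of fun i j => star (y i) * y j) : CStarMatrix ι ι C) =
      star (CStarMatrix.ofMatrix (Matrix.of fun i j => if i = r then y j else 0)) *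
        CStarMatrix.ofMatrix (Matrix.of fun i j => if i = r then y j else 0) := by
    ext i j
    rw [CStarMatrix.mul_apply, Finset.sum_eq_single r]
    · simp [CStarMatrix.star_apply]
    · intro b _ hb
      simp [hb]
    · simp
  rw [this]
  exact star_mul_self_nonneg _

theorem sum_entry {C : Type*} [AddCommMonoid C] {ι κ : Type*} (s : Finset κ)
    (f : κ → CStarMatrix ι ι C) (i j : ι) : (∑ r ∈ s, f r) i j = ∑ r ∈ s, f r i j := by
  classical
  induction s using Finset.induction_on with
  | empty => rfl
  | insert r s hr ih => rw [Finset.sum_insert hr, Finset.sum_insert hr, CStarMatrix.add_apply, ih]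

theorem sum_rearrange {C α β γ δ : Type*} [AddCommMonoid C] [Fintype α] [Fintype β] [Fintype γ]
    [Fintype δ] (f : α → β → γ → δ → C) :
    ∑ q, ∑ p, ∑ s, ∑ r, f r s q p = ∑ r, ∑ s, ∑ q, ∑ p, f r s q p := by
  calc ∑ q, ∑ p, ∑ s, ∑ r, f r s q p = ∑ q, ∑ s, ∑ p, ∑ r, f r s q p :=
        Finset.sum_congr rfl fun q _ => Finset.sum_comm
    _ = ∑ s, ∑ q, ∑ p, ∑ r, f r s q p := Finset.sum_comm
    _ = ∑ s, ∑ q, ∑ r, ∑ p, f r s q p :=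
        Finset.sum_congr rfl fun s _ => Finset.sum_congr rfl fun q _ => Finset.sum_comm
    _ = ∑ s, ∑ r, ∑ q, ∑ p, f r s q p := Finset.sum_congr rfl fun s _ => Finset.sum_comm
    _ = ∑ r, ∑ s, ∑ q, ∑ p, f r s q p := Finset.sum_comm

theorem exists_gram_factor (T : A →CP A) {ι : Type} [Fintype ι] (a : ι → A) :
    ∃ c : ι → ι → A, ∀ p q, T (star (a p) * a q) = ∑ r, star (c r p) * c r q :=
  exists_factor _ (T.map_cstarMatrix_nonneg _ (gram_nonneg a))

theorem gramMap_nonneg_emb {k : ℕ} (x : Fin k → A ⊗[ℂ] B) :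
    0 ≤ (CStarMatrix.ofMatrix (Matrix.of fun i j => emb (algMap T S (star (x i) * x j))) :
      CStarMatrix (Fin k) (Fin k) (MinTensor A B)) := by
  obtain ⟨n, a, b, hx⟩ := exists_common x
  obtain ⟨c, hc⟩ := exists_gram_factor T a
  obtain ⟨d, hd⟩ := exists_gram_factor S b
  have : (CStarMatrix.ofMatrix (Matrix.of fun i j => emb (algMap T S (star (x i) * x j))) :
      CStarMatrix (Fin k) (Fin k) (MinTensor A B)) =
      ∑ r, ∑ s, (CStarMatrix.ofMatrix (Matrix.of fun i j =>
        star (emb (∑ p, c r ⟨i, p⟩ ⊗ₜ[ℂ] d s ⟨i, p⟩)) *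
          emb (∑ p, c r ⟨j, p⟩ ⊗ₜ[ℂ] d s ⟨j, p⟩))) := by
    ext i j
    simp only [sum_entry]
    change emb (algMap T S (star (x i) * x j)) = ∑ r, ∑ s,
        star (emb (∑ p, c r ⟨i, p⟩ ⊗ₜ[ℂ] d s ⟨i, p⟩)) *
          emb (∑ p, c r ⟨j, p⟩ ⊗ₜ[ℂ] d s ⟨j, p⟩)
    simp only [← map_star, ← map_mul, ← map_sum]
    congr 1
    simp only [hx, star_sum, Finset.sum_mul, Finset.mul_sum, map_sum, TensorProduct.star_tmul,
      Algebra.TensorProduct.tmul_mul_tmul, algMap_tmul, hc, hd, TensorProduct.sum_tmul,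
      TensorProduct.tmul_sum]
    exact sum_rearrange (fun r s q p =>
      (star (c r ⟨i, p⟩) * c r ⟨j, q⟩) ⊗ₜ[ℂ] (star (d s ⟨i, p⟩) * d s ⟨j, q⟩))
  rw [this]
  exact Finset.sum_nonneg fun r _ => Finset.sum_nonneg fun s _ => gram_nonneg _

theorem gramMap_nonneg {k : ℕ} (y : Fin k → MinTensor A B) :
    0 ≤ (CStarMatrix.ofMatrix (Matrix.of fun i j => mapL T S hT hS (star (y i) * y j)) :
      CStarMatrix (Fin k) (Fin k) (MinTensor A B)) := by
  have hd : DenseRange (Pi.map fun (_ : Fin k) (x : A ⊗[ℂ] B) => (emb x : MinTensor A B)) :=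
    DenseRange.piMap fun _ => denseRange_emb
  refine hd.induction_on y ?_ fun x => ?_
  · refine isClosed_Ici.preimage (f := fun y : Fin k → MinTensor A B =>
      (CStarMatrix.ofMatrix (Matrix.of fun i j => mapL T S hT hS (star (y i) * y j)) :
        CStarMatrix (Fin k) (Fin k) (MinTensor A B))) ?_
    refine continuous_pi fun i => continuous_pi fun j => ?_
    change Continuous fun y : Fin k → MinTensor A B => mapL T S hT hS (star (y i) * y j)
    fun_prop
  · have := gramMap_nonneg_emb T S x
    convert this using 5 with i j
    rw [Pi.map_apply, Pi.map_apply, ← map_star, ← map_mul, mapL_emb]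

/-- The tensor product `T ⊗ S` of two ucp maps, as a completely positive map. -/
def mapCP : MinTensor A B →CP MinTensor A B :=
  { (mapL T S hT hS : MinTensor A B →ₗ[ℂ] MinTensor A B) with
    map_cstarMatrix_nonneg' := fun k M hM => by
      obtain ⟨N, hN⟩ := exists_factor M hM
      have : M.map (mapL T S hT hS : MinTensor A B →ₗ[ℂ] MinTensor A B) =
          ∑ r, (CStarMatrix.ofMatrix (Matrix.of fun i j =>
            mapL T S hT hS (star (N r i) * N r j)) :
            CStarMatrix (Fin k) (Fin k) (MinTensor A B)) := by
        ext i j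
        rw [sum_entry]
        change mapL T S hT hS (M i j) = ∑ r, mapL T S hT hS (star (N r i) * N r j)
        rw [hN, map_sum]
      change 0 ≤ M.map (mapL T S hT hS : MinTensor A B →ₗ[ℂ] MinTensor A B)
      rw [this]
      exact Finset.sum_nonneg fun r _ => gramMap_nonneg T S hT hS (N r) }

theorem mapCP_tmul (a : A) (b : B) : mapCP T S hT hS (tmul a b) = tmul (T a) (S b) :=
  mapL_emb T S hT hS (a ⊗ₜ b)

theorem mapCP_one : mapCP T S hT hS 1 = 1 := by
  have := mapL_emb T S hT hS (1 : A ⊗[ℂ] B)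
  rwa [algMap_one hT hS, map_one] at this

end Maps

end MinTensor

/-- A state: a continuous linear functional with `φ (x* x) ≥ 0` for all `x` and `φ 1 = 1`. -/
def IsState {A : Type*} [CStarAlgebra A] (φ : StrongDual ℂ A) : Prop :=
  (∀ x, 0 ≤ φ (star x * x)) ∧ φ 1 = 1

namespace MinTensor

open UniformSpace

section States

variable {A : Type u} {B : Type v} [CStarAlgebra A] [CStarAlgebra B]

/-- The functional `a ⊗ b ↦ φ a ψ b` on the algebraic tensor product. -/
def algFun (φ : StrongDual ℂ A) (ψ : StrongDual ℂ B) : A ⊗[ℂ] B →ₗ[ℂ] ℂ :=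
  LinearMap.mul' ℂ ℂ ∘ₗ TensorProduct.map φ.toLinearMap ψ.toLinearMap

theorem algFun_tmul (φ : StrongDual ℂ A) (ψ : StrongDual ℂ B) (a : A) (b : B) :
    algFun φ ψ (a ⊗ₜ b) = φ a * ψ b := rfl

theorem exists_cyclic {φ : StrongDual ℂ A} (hφ : IsState φ) :
    ∃ (π : HilbertRep A) (ζ : π.carrier), ∀ a, ⟪ζ, π.rep a ζ⟫_ℂ = φ a := by
  let _ : PartialOrder A := CStarAlgebra.spectralOrder A
  let _ : StarOrderedRing A := CStarAlgebra.spectralOrderedRing A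
  obtain ⟨π, Λ, h⟩ := exists_gns (PositiveLinearMap.mk₀ (φ : A →ₗ[ℂ] ℂ) fun x hx => by
    obtain ⟨y, rfl⟩ := exists_star_mul_self x hx
    exact hφ.1 y)
  refine ⟨π, Λ 1, fun a => ?_⟩
  rw [h, star_one, one_mul, mul_one]
  rfl

theorem exists_cyclic_tensor {φ : StrongDual ℂ A} {ψ : StrongDual ℂ B} (hφ : IsState φ)
    (hψ : IsState ψ) : ∃ (π : HilbertRep A) (ρ : HilbertRep B)
      (ζ : HilbertTensor π.carrier ρ.carrier), ‖ζ‖ = 1 ∧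
        ∀ x, ⟪ζ, tensorRep π ρ x ζ⟫_ℂ = algFun φ ψ x := by
  obtain ⟨π, ζ, h⟩ := exists_cyclic hφ
  obtain ⟨ρ, ζ', h'⟩ := exists_cyclic hψ
  have key : ∀ x, ⟪vtmul ζ ζ', tensorRep π ρ x (vtmul ζ ζ')⟫_ℂ = algFun φ ψ x := fun x => by
    induction x with
    | zero => simp
    | add x y hx hy => simp only [map_add, add_apply, inner_add_right, hx, hy]
    | tmul a b => rw [tensorRep_tmul, opTensor_vtmul, inner_vtmul, h, h', algFun_tmul]
  refine ⟨π, ρ, vtmul ζ ζ', ?_, key⟩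
  have h1 := key 1
  rw [map_one, Algebra.TensorProduct.one_def, algFun_tmul, hφ.2, hψ.2,
    one_apply_eq_self, inner_self_eq_norm_sq_to_K] at h1
  have h2 : ‖vtmul ζ ζ'‖ ^ 2 = 1 := by
    rw [one_mul] at h1
    exact RCLike.ofReal_injective (K := ℂ) (by simpa using h1)
  exact (pow_eq_one_iff_of_nonneg (norm_nonneg _) two_ne_zero).mp h2

theorem norm_algFun_le {φ : StrongDual ℂ A} {ψ : StrongDual ℂ B} (hφ : IsState φ)
    (hψ : IsState ψ) (x : A ⊗[ℂ] B) : ‖algFun φ ψ x‖ ≤ minNorm x := by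
  obtain ⟨π, ρ, ζ, hζ, h⟩ := exists_cyclic_tensor hφ hψ
  rw [← h]
  refine (norm_inner_le_norm _ _).trans ?_
  rw [hζ, one_mul]
  have := ContinuousLinearMap.le_of_opNorm_le _ (norm_tensorRep_le π ρ x) ζ
  rwa [hζ, mul_one] at this

/-- The product functional on the algebraic tensor product, continuous for the minimal norm. -/
def preState (φ : StrongDual ℂ A) (ψ : StrongDual ℂ B) (hφ : IsState φ) (hψ : IsState ψ) :
    Pre A B →L[ℂ] ℂ :=
  LinearMap.mkContinuous (algFun φ ψ : A ⊗[ℂ] B →ₗ[ℂ] ℂ) 1 fun x => by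
    rw [one_mul]
    exact norm_algFun_le hφ hψ x

/-- The product state `φ ⊗ ψ` on the minimal tensor product. -/
def prodState (φ : StrongDual ℂ A) (ψ : StrongDual ℂ B) (hφ : IsState φ) (hψ : IsState ψ) :
    StrongDual ℂ (MinTensor A B) :=
  (preState φ ψ hφ hψ).fromCompletion

variable (φ : StrongDual ℂ A) (ψ : StrongDual ℂ B) (hφ : IsState φ) (hψ : IsState ψ)

theorem prodState_emb (x : A ⊗[ℂ] B) : prodState φ ψ hφ hψ (emb x) = algFun φ ψ x :=
  ContinuousLinearMap.fromCompletion_apply_coe _ _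

theorem prodState_tmul (a : A) (b : B) : prodState φ ψ hφ hψ (tmul a b) = φ a * ψ b :=
  prodState_emb φ ψ hφ hψ (a ⊗ₜ b)

theorem isState_prodState : IsState (prodState φ ψ hφ hψ) := by
  constructor
  · intro x
    refine denseRange_emb.induction_on x ?_ fun x => ?_
    · apply isClosed_le <;> fun_prop
    · obtain ⟨π, ρ, ζ, hζ, h⟩ := exists_cyclic_tensor hφ hψ
      rw [← map_star, ← map_mul, prodState_emb, ← h, map_mul, map_star, mul_apply_eq_comp,
        ContinuousLinearMap.star_eq_adjoint, ContinuousLinearMap.adjoint_inner_right,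
        inner_self_eq_norm_sq_to_K]
      positivity
  · have := prodState_tmul φ ψ hφ hψ 1 1
    rwa [hφ.2, hψ.2, one_mul, tmul, ← Algebra.TensorProduct.one_def, map_one] at this

end States

end MinTensor

/-- A state preserving C⋆-dynamical system `(A, φ, T)`: a ucp map `T` and a `T`-invariant
state `φ` on the unital C⋆-algebra `A`. -/
structure CStarSystem (A : Type u) [CStarAlgebra A] [PartialOrder A] [StarOrderedRing A] where
  state : StrongDual ℂ A
  map : A →CP A
  isState : IsState state
  map_one : map 1 = 1
  invariant : ∀ x, state (map x) = state x

namespace CStarSystem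

variable {A : Type u} [CStarAlgebra A] [PartialOrder A] [StarOrderedRing A]
  {B : Type v} [CStarAlgebra B] [PartialOrder B] [StarOrderedRing B]

/-- `φ` is the only `T`-invariant state. -/
def UniquelyErgodic (X : CStarSystem A) : Prop :=
  ∀ ω : StrongDual ℂ A, IsState ω → (∀ x, ω (X.map x) = ω x) → ω = X.state

/-- `(1/n) ∑_{k<n} |ψ (T^k x) - ψ 1 φ x| → 0` for all `x ∈ A` and `ψ ∈ A*`. -/
def StrictlyWeakMixing (X : CStarSystem A) : Prop :=
  ∀ (x : A) (ψ : StrongDual ℂ A),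
    Filter.Tendsto (fun n : ℕ => (1 / (n : ℝ)) *
      ∑ k ∈ Finset.range n, ‖ψ (X.map^[k] x) - ψ 1 * X.state x‖) Filter.atTop (nhds 0)

/-- The tensor product system `(A ⊗ B, φ ⊗ φ₁, T ⊗ H)` on the minimal tensor product. -/
def tensor (X : CStarSystem A) (Y : CStarSystem B) : CStarSystem (MinTensor A B) where
  state := MinTensor.prodState X.state Y.state X.isState Y.isState
  map := MinTensor.mapCP X.map Y.map X.map_one Y.map_one
  isState := MinTensor.isState_prodState _ _ _ _
  map_one := MinTensor.mapCP_one _ _ _ _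
  invariant x := by
    change MinTensor.prodState X.state Y.state X.isState Y.isState
      (MinTensor.mapL X.map Y.map X.map_one Y.map_one x) = _
    refine MinTensor.denseRange_emb.induction_on x ?_ fun x => ?_
    · apply isClosed_eq <;> fun_prop
    · rw [MinTensor.mapL_emb, MinTensor.prodState_emb, MinTensor.prodState_emb]
      induction x with
      | zero => simp
      | add x y hx hy => simp only [_root_.map_add, hx, hy]
      | tmul a b =>
        rw [MinTensor.algMap_tmul, MinTensor.algFun_tmul, MinTensor.algFun_tmul, X.invariant,
          Y.invariant]

theorem tensor_state_tmul (X : CStarSystem A) (Y : CStarSystem B) (a : A) (b : B) :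
    (X.tensor Y).state (MinTensor.tmul a b) = X.state a * Y.state b :=
  MinTensor.prodState_tmul _ _ _ _ a b

theorem tensor_map_tmul (X : CStarSystem A) (Y : CStarSystem B) (a : A) (b : B) :
    (X.tensor Y).map (MinTensor.tmul a b) = MinTensor.tmul (X.map a) (Y.map b) :=
  MinTensor.mapCP_tmul _ _ _ _ a b

end CStarSystem

/-- `(A ⊗ B)* = A* ⊗ B*`: the finite sums of product functionals `f ⊗ g`, with `f ∈ A*` and
`g ∈ B*`, are norm dense in `(A ⊗ B)*`. (A functional on `A ⊗ B` is determined by its values on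
elementary tensors, so `ω = f ⊗ g` says `ω (a ⊗ b) = f a * g b`.) -/
def DualTensorDense (A : Type u) (B : Type v) [CStarAlgebra A] [CStarAlgebra B] : Prop :=
  (Submodule.span ℂ {ω : StrongDual ℂ (MinTensor A B) |
    ∃ (f : StrongDual ℂ A) (g : StrongDual ℂ B),
      ∀ a b, ω (MinTensor.tmul a b) = f a * g b}).topologicalClosure = ⊤

end

/-!
If the square system is uniquely ergodic, the averages of an element of `A ⊗ A` along `T ⊗ T`,
evaluated at states `ψₙ` that may depend on the length `n` of the average, converge to its mean:
the averaged functionals are states, and their weak-* cluster points are invariant states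
(`CStarSystem.UniquelyErgodic.tendsto_average`). For `y` with `φ y = 0`, apply this to `y ⊗ y*` and
the product states `ψₙ ⊗ ψₙ`. As `(ψₙ ⊗ ψₙ) ((T ⊗ T)^k (y ⊗ y*)) = |ψₙ (T^k y)|²`, the mean squares
of `ψₙ (T^k y)` tend to zero, hence so do the averages of `|ψₙ (T^k y)|`.

Arbitrary functionals are reached without decomposing them into states. The sum of the
`|ψ (T^k y)|` over `k < n` is the value of `ψ` at a unimodular combination of the `T^k y`, so it is
at most `‖ψ‖` times the norm of that combination. The norm of an element is at most a constant times
its modulus at a suitable state (`exists_isState_norm_le`), and the triangle inequality at that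
state, which depends on `n`, leads back to the previous case
(`CStarSystem.exists_isState_average_le`). That states determine the norm follows by separating the
cone of positive elements from a point outside it.

Conversely, an invariant state has constant deviations from `φ`, so strict weak mixing forces it to
equal `φ`. Finally, for product functionals and elementary tensors the mixing condition on the
tensor product reduces to that on the factors; the deviation `ψ (T^k x) - ψ 1 φ x` is bilinear and
bounded uniformly in `k`, so the condition extends to closed spans in both variables, which under
the density assumption on the dual is everything (`CStarSystem.StrictlyWeakMixing.tensor`).
-/

/-! ### States and the norm -/

section States

variable {A : Type u} [CStarAlgebra A]

theorem IsState.norm_apply_le {φ : StrongDual ℂ A} (hφ : IsState φ) (x : A) : ‖φ x‖ ≤ ‖x‖ := by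
  obtain ⟨π, ζ, h⟩ := MinTensor.exists_cyclic hφ
  have hζ : ‖ζ‖ = 1 := by
    have h1 := h 1
    rw [map_one, hφ.2, one_apply_eq_self, inner_self_eq_norm_sq_to_K] at h1
    exact (pow_eq_one_iff_of_nonneg (norm_nonneg _) two_ne_zero).mp
      (RCLike.ofReal_injective (K := ℂ) (by simpa using h1))
  have h2 := (π.rep x).le_opNorm ζ
  have h3 := norm_inner_le_norm (𝕜 := ℂ) ζ (π.rep x ζ)
  rw [h, hζ, one_mul] at h3
  rw [hζ, mul_one] at h2
  exact h3.trans (h2.trans (NonUnitalStarAlgHom.norm_apply_le π.rep x))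

theorem IsState.apply_star {φ : StrongDual ℂ A} (hφ : IsState φ) (x : A) :
    φ (star x) = star (φ x) := by
  obtain ⟨π, ζ, h⟩ := MinTensor.exists_cyclic hφ
  rw [← h, ← h, MinTensor.inner_rep_star']
  exact (inner_conj_symm _ _).symm

theorem IsState.nontrivial {φ : StrongDual ℂ A} (hφ : IsState φ) : Nontrivial A :=
  ⟨1, 0, fun h => by simpa [h] using hφ.2⟩

variable [PartialOrder A] [StarOrderedRing A]

theorem IsState.apply_nonneg {φ : StrongDual ℂ A} (hφ : IsState φ) {x : A} (hx : 0 ≤ x) :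
    0 ≤ φ x := by
  obtain ⟨y, rfl⟩ := MinTensor.exists_star_mul_self x hx
  exact hφ.1 y

/-- States detect the order: a self-adjoint element is bounded above by any real number bounding
its values on all states. The closed cone of positive elements is separated from a non-positive
element by a real functional, whose complexification is a multiple of a state. -/
theorem IsSelfAdjoint.le_algebraMap_of_forall_isState {a : A} (ha : IsSelfAdjoint a) {c : ℝ}
    (h : ∀ φ : StrongDual ℂ A, IsState φ → (φ a).re ≤ c) : a ≤ algebraMap ℝ A c := by
  by_contra hac
  obtain ⟨f, hf, hfa⟩ := (ProperCone.positive ℝ A).hyperplane_separation_point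
    (x₀ := algebraMap ℝ A c - a) fun h0 => hac (sub_nonneg.mp h0)
  simp only [ProperCone.mem_positive] at hf
  have hmono : ∀ x y : A, x ≤ y → f x ≤ f y := fun x y hxy => by
    simpa using hf _ (sub_nonneg.mpr hxy)
  have hf1 : ∀ r : ℝ, f (algebraMap ℝ A r) = r * f 1 := fun r => by
    rw [Algebra.algebraMap_eq_smul_one, map_smul, smul_eq_mul]
  have hpos : 0 < f 1 := by
    refine lt_of_le_of_ne (hf 1 zero_le_one) fun h0 => ?_
    have h1 := hmono _ _ ha.le_algebraMap_norm_self
    rw [map_sub, hf1] at hfa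
    rw [hf1] at h1
    rw [← h0] at hfa h1
    linarith
  -- Symmetrising `f` makes its complexification real on self-adjoint elements.
  let g : StrongDual ℝ A := (2 * f 1)⁻¹ • (f + f ∘L (starL' ℝ : A ≃L[ℝ] A).toContinuousLinearMap)
  have hg : ∀ x, g x = (2 * f 1)⁻¹ * (f x + f (star x)) := fun x => rfl
  let ψ : StrongDual ℂ A := g.extendRCLike
  have hψ : ∀ x : A, IsSelfAdjoint x → ψ x = ((f 1)⁻¹ * f x : ℝ) := fun x hx => by
    have h1 : g x = (f 1)⁻¹ * f x := by
      rw [hg, hx.star_eq]; field_simp; ring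
    have h2 : g (Complex.I • x) = 0 := by
      rw [hg, star_smul, hx.star_eq]; simp
    have : ψ x = (g x : ℂ) - Complex.I * (g (Complex.I • x) : ℂ) :=
      StrongDual.extendRCLike_apply g x
    rw [this, h1, h2]; simp
  have hst : IsState ψ := by
    refine ⟨fun x => ?_, ?_⟩
    · rw [hψ _ (.star_mul_self x)]
      exact_mod_cast mul_nonneg (inv_nonneg.mpr hpos.le) (hf _ (star_mul_self_nonneg x))
    · rw [hψ _ (.one A), inv_mul_cancel₀ hpos.ne', Complex.ofReal_one]
  have h3 := h ψ hst
  rw [hψ a ha, Complex.ofReal_re, inv_mul_le_iff₀ hpos] at h3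
  rw [map_sub, hf1] at hfa
  linarith

theorem IsSelfAdjoint.norm_le_of_forall_isState [Nontrivial A] {a : A} (ha : IsSelfAdjoint a)
    {c : ℝ} (h : ∀ φ : StrongDual ℂ A, IsState φ → ‖φ a‖ ≤ c) : ‖a‖ ≤ c := by
  have h1 := ha.le_algebraMap_of_forall_isState (c := c) fun φ hφ =>
    (Complex.re_le_norm _).trans (h φ hφ)
  have h2 := ha.neg.le_algebraMap_of_forall_isState (c := c) fun φ hφ => by
    rw [map_neg]
    exact (Complex.re_le_norm _).trans (by rw [norm_neg]; exact h φ hφ)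
  rw [le_algebraMap_iff_spectrum_le] at h1
  rw [le_algebraMap_iff_spectrum_le (a := -a) ha.neg] at h2
  rcases CStarAlgebra.norm_or_neg_norm_mem_spectrum ha with h3 | h3
  · exact h1 _ h3
  · refine h2 _ ?_
    rw [← spectrum.neg_eq]
    simpa using h3

/-- The numerical radius is equivalent to the norm; the constant `3` in place of `2` leaves room
for a state that need not attain the supremum. -/
theorem exists_isState_norm_le [Nontrivial A] (a : A) :
    ∃ φ : StrongDual ℂ A, IsState φ ∧ ‖a‖ ≤ 3 * ‖φ a‖ := by
  have key : ∀ (a : A) (c : ℝ), (∀ φ : StrongDual ℂ A, IsState φ → ‖φ a‖ ≤ c) →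
      ‖a‖ ≤ 2 * c := fun a c h => by
    have hstar : ∀ φ : StrongDual ℂ A, IsState φ → ‖φ (star a)‖ ≤ c := fun φ hφ => by
      rw [hφ.apply_star, norm_star]; exact h φ hφ
    have h1 : ‖a + star a‖ ≤ 2 * c :=
      (IsSelfAdjoint.add_star_self a).norm_le_of_forall_isState fun φ hφ => by
        rw [map_add]
        linarith [norm_add_le (φ a) (φ (star a)), h φ hφ, hstar φ hφ]
    have h2 : ‖Complex.I • (a - star a)‖ ≤ 2 * c := by
      refine IsSelfAdjoint.norm_le_of_forall_isState ?_ fun φ hφ => ?_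
      · rw [isSelfAdjoint_iff, star_smul, star_sub, star_star, Complex.star_def, Complex.conj_I,
          neg_smul, ← smul_neg, neg_sub]
      · rw [map_smul, norm_smul, Complex.norm_I, one_mul, map_sub]
        linarith [norm_sub_le (φ a) (φ (star a)), h φ hφ, hstar φ hφ]
    rw [norm_smul, Complex.norm_I, one_mul] at h2
    have h3 : (2 : ℂ) • a = (a + star a) + (a - star a) := by rw [two_smul]; abel
    have h4 := norm_add_le (a + star a) (a - star a)
    rw [← h3, norm_smul, Complex.norm_ofNat] at h4
    linarith
  by_contra! hcon
  have h0 : ‖a‖ ≤ 2 * (‖a‖ / 3) := key a _ fun φ hφ => by linarith [hcon φ hφ]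
  -- Without any state, `key` with a negative bound would give a negative norm.
  have h1 : ‖a‖ ≤ 2 * (-1) := key a _ fun φ hφ => by
    linarith [hcon φ hφ, norm_nonneg (φ a)]
  linarith [norm_nonneg a]

/-- The pullback of a state along an iterate of a unital completely positive map is a state. -/
theorem IsState.exists_comp_iterate {T : A →CP A} (hT : T 1 = 1) (k : ℕ) {φ : StrongDual ℂ A}
    (hφ : IsState φ) : ∃ ω : StrongDual ℂ A, IsState ω ∧ ∀ x, ω x = φ (T^[k] x) := by
  induction k with
  | zero => exact ⟨φ, hφ, fun x => rfl⟩
  | succ k ih =>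
    obtain ⟨ω, hω, h⟩ := ih
    refine ⟨ω.comp ⟨T.toLinearMap, map_continuous T⟩, ⟨fun x => ?_, ?_⟩, fun x => ?_⟩
    · exact hω.apply_nonneg (map_nonneg T (star_mul_self_nonneg x))
    · change ω (T 1) = 1
      rw [hT, hω.2]
    · rw [Function.iterate_succ_apply]
      exact h (T x)

namespace CStarSystem

theorem nontrivial (X : CStarSystem A) : Nontrivial A := X.isState.nontrivial

theorem norm_iterate_le (X : CStarSystem A) (k : ℕ) (x : A) : ‖X.map^[k] x‖ ≤ 3 * ‖x‖ := by
  have := X.nontrivial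
  obtain ⟨φ, hφ, h⟩ := exists_isState_norm_le (X.map^[k] x)
  obtain ⟨ω, hω, hk⟩ := hφ.exists_comp_iterate X.map_one k
  rw [← hk] at h
  linarith [hω.norm_apply_le x]

end CStarSystem

end States

/-! ### Cesàro null sequences -/

section Cesaro

/-- A sequence of complex numbers is Cesàro null if the averages of its absolute values tend to
zero. -/
def CesaroNull (a : ℕ → ℂ) : Prop :=
  Filter.Tendsto (fun n : ℕ => (1 / (n : ℝ)) * ∑ k ∈ Finset.range n, ‖a k‖) Filter.atTop (nhds 0)

namespace CesaroNull

theorem average_nonneg (a : ℕ → ℂ) (n : ℕ) :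
    0 ≤ (1 / (n : ℝ)) * ∑ k ∈ Finset.range n, ‖a k‖ := by positivity

theorem average_const_le {c : ℝ} (hc : 0 ≤ c) (n : ℕ) :
    (1 / (n : ℝ)) * ∑ _k ∈ Finset.range n, c ≤ c := by
  rw [Finset.sum_const, Finset.card_range, nsmul_eq_mul, ← mul_assoc]
  refine mul_le_of_le_one_left hc ?_
  rw [one_div]
  exact inv_mul_le_one

theorem zero : CesaroNull 0 := by simp [CesaroNull]

theorem of_norm_le {a b : ℕ → ℂ} (hb : CesaroNull b) (C : ℝ) (h : ∀ k, ‖a k‖ ≤ C * ‖b k‖) :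
    CesaroNull a := by
  have h0 := Filter.Tendsto.const_mul C hb
  rw [mul_zero] at h0
  refine squeeze_zero (average_nonneg a) (fun n => ?_) h0
  refine (mul_le_mul_of_nonneg_left (Finset.sum_le_sum fun k _ => h k) (by positivity)).trans_eq ?_
  rw [← Finset.mul_sum, mul_left_comm]

theorem add {a b : ℕ → ℂ} (ha : CesaroNull a) (hb : CesaroNull b) : CesaroNull (a + b) := by
  have h0 := Filter.Tendsto.add ha hb
  rw [add_zero] at h0
  refine squeeze_zero (average_nonneg _) (fun n => ?_) h0
  rw [← mul_add, ← Finset.sum_add_distrib]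
  gcongr
  exact norm_add_le _ _

theorem of_forall_approx {a : ℕ → ℂ}
    (h : ∀ ε > 0, ∃ b, CesaroNull b ∧ ∀ k, ‖a k - b k‖ ≤ ε) : CesaroNull a := by
  refine Metric.tendsto_atTop.mpr fun ε hε => ?_
  obtain ⟨b, hb, hab⟩ := h (ε / 2) (half_pos hε)
  obtain ⟨N, hN⟩ := Metric.tendsto_atTop.mp hb (ε / 2) (half_pos hε)
  refine ⟨N, fun n hn => ?_⟩
  have h1 := hN n hn
  rw [Real.dist_0_eq_abs, abs_of_nonneg (average_nonneg _ _)] at h1 ⊢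
  calc (1 / (n : ℝ)) * ∑ k ∈ Finset.range n, ‖a k‖
      ≤ (1 / (n : ℝ)) * ∑ k ∈ Finset.range n, (ε / 2 + ‖b k‖) := by
        gcongr with k
        linarith [norm_le_norm_sub_add (a k) (b k), hab k]
    _ = (1 / (n : ℝ)) * ∑ _k ∈ Finset.range n, ε / 2 +
          (1 / (n : ℝ)) * ∑ k ∈ Finset.range n, ‖b k‖ := by
        rw [Finset.sum_add_distrib, mul_add]
    _ < ε := by linarith [average_const_le (half_pos hε).le n]

/-- A constant Cesàro null sequence vanishes. -/
theorem eq_zero_of_const {c : ℂ} (h : CesaroNull fun _ => c) : c = 0 := by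
  have h1 : Filter.Tendsto (fun n : ℕ => (1 / (n : ℝ)) * ∑ _k ∈ Finset.range n, ‖c‖)
      Filter.atTop (nhds ‖c‖) := by
    refine tendsto_const_nhds.congr' ?_
    filter_upwards [Filter.eventually_gt_atTop 0] with n hn
    rw [Finset.sum_const, Finset.card_range, nsmul_eq_mul]
    field_simp
  exact norm_eq_zero.mp (tendsto_nhds_unique h1 h)

variable {V : Type*} [SeminormedAddCommGroup V] [NormedSpace ℂ V]

/-- The vectors on which a sequence of linear functionals is Cesàro null. -/
def submodule (F : ℕ → V →ₗ[ℂ] ℂ) : Submodule ℂ V where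
  carrier := {v | CesaroNull fun k => F k v}
  add_mem' {v w} hv hw := by simpa [Pi.add_def] using! hv.add hw
  zero_mem' := by simpa [Pi.zero_def] using! zero
  smul_mem' c v hv := hv.of_norm_le ‖c‖ fun k => by simp

theorem mem_submodule {F : ℕ → V →ₗ[ℂ] ℂ} {v : V} :
    v ∈ submodule F ↔ CesaroNull fun k => F k v := Iff.rfl

theorem isClosed_submodule {F : ℕ → V →ₗ[ℂ] ℂ} {C : ℝ} (hF : ∀ k v, ‖F k v‖ ≤ C * ‖v‖) :
    IsClosed (submodule F : Set V) := by
  refine isClosed_of_closure_subset fun v hv => of_forall_approx fun ε hε => ?_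
  obtain ⟨w, hw, hvw⟩ := Metric.mem_closure_iff.mp hv (ε / (|C| + 1)) (by positivity)
  refine ⟨_, hw, fun k => ?_⟩
  rw [← map_sub]
  rw [dist_eq_norm, lt_div_iff₀ (by positivity)] at hvw
  have h1 : C * ‖v - w‖ ≤ |C| * ‖v - w‖ := by gcongr; exact le_abs_self C
  linarith [hF k (v - w), norm_nonneg (v - w)]

end CesaroNull

end Cesaro

namespace CStarSystem

/-! ### Unique ergodicity and convergence of averages -/

section Averages

variable {A : Type u} [CStarAlgebra A] [PartialOrder A] [StarOrderedRing A]

/-- In a uniquely ergodic system the averages of an element along the dynamics converge to its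
mean uniformly on the state space: the state may vary with the length of the average, since every
weak-* cluster point of the averaged states is an invariant state. -/
theorem UniquelyErgodic.tendsto_average {X : CStarSystem A} (hX : X.UniquelyErgodic)
    {ψ : ℕ → StrongDual ℂ A} (hψ : ∀ n, IsState (ψ n)) (x : A) :
    Filter.Tendsto (fun n : ℕ => (n : ℂ)⁻¹ * ∑ k ∈ Finset.range n, ψ n (X.map^[k] x))
      Filter.atTop (nhds (X.state x)) := by
  choose ω hω hωψ using fun n k => (hψ n).exists_comp_iterate X.map_one k
  let avg : ℕ → StrongDual ℂ A := fun n => (n : ℂ)⁻¹ • ∑ k ∈ Finset.range n, ω n k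
  have havg : ∀ n y, avg n y = (n : ℂ)⁻¹ * ∑ k ∈ Finset.range n, ψ n (X.map^[k] y) := fun n y => by
    simp [avg, ← hωψ]
  have hnorm : ∀ n y, ‖avg n y‖ ≤ ‖y‖ := fun n y => by
    rw [havg, norm_mul, norm_inv, Complex.norm_natCast, ← one_div]
    refine le_trans ?_ (CesaroNull.average_const_le (norm_nonneg y) n)
    gcongr
    refine norm_sum_le_of_le _ fun k _ => ?_
    rw [← hωψ]
    exact (hω n k).norm_apply_le y
  have hcomp := WeakDual.isCompact_closedBall (𝕜 := ℂ) (0 : StrongDual ℂ A) 1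
  rw [Filter.tendsto_iff_ultrafilter]
  intro U hU
  obtain ⟨η, -, hη⟩ := hcomp.ultrafilter_le_nhds
    (U.map fun n => StrongDual.toWeakDual (avg n)) (by
      rw [Filter.le_principal_iff, Ultrafilter.mem_coe, Ultrafilter.mem_map]
      refine Filter.univ_mem' fun n => ?_
      change avg n ∈ Metric.closedBall 0 1
      rw [mem_closedBall_zero_iff]
      exact ContinuousLinearMap.opNorm_le_bound _ zero_le_one fun y => by
        rw [one_mul]; exact hnorm n y)
  let ξ : StrongDual ℂ A := WeakDual.toStrongDual η
  have hξ : ∀ y, Filter.Tendsto (fun n => avg n y) U (nhds (ξ y)) := fun y =>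
    ((WeakDual.eval_continuous y).tendsto η).comp
      (show Filter.Tendsto (fun n => StrongDual.toWeakDual (avg n)) U (nhds η) from hη)
  have hstate : IsState ξ := by
    refine ⟨fun y => ge_of_tendsto' (hξ _) fun n => ?_, tendsto_nhds_unique (hξ 1) ?_⟩
    · rw [havg]
      refine mul_nonneg (inv_nonneg.mpr (Nat.cast_nonneg n)) (Finset.sum_nonneg fun k _ => ?_)
      rw [← hωψ]
      exact (hω n k).1 y
    · refine (tendsto_const_nhds.congr' ?_).mono_left hU
      filter_upwards [Filter.eventually_gt_atTop 0] with n hn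
      have h1 : ∀ k, ψ n (X.map^[k] 1) = 1 := fun k => by rw [← hωψ, (hω n k).2]
      have hn' : (n : ℂ) ≠ 0 := by exact_mod_cast hn.ne'
      simp [havg, h1, hn']
  have hinv : ∀ y, ξ (X.map y) = ξ y := fun y => by
    -- The averages at `X.map y` and at `y` differ by a telescoping sum divided by `n`.
    have h0 : Filter.Tendsto (fun n : ℕ => (n : ℝ)⁻¹ * (2 * ‖y‖)) Filter.atTop (nhds 0) := by
      simpa using tendsto_natCast_atTop_atTop.inv_tendsto_atTop.mul_const (2 * ‖y‖)
    have h1 : Filter.Tendsto (fun n => avg n (X.map y) - avg n y) Filter.atTop (nhds 0) := by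
      refine squeeze_zero_norm (fun n => ?_) h0
      rw [havg, havg, ← mul_sub, ← Finset.sum_sub_distrib]
      simp only [← Function.iterate_succ_apply]
      rw [Finset.sum_range_sub (fun k => ψ n (X.map^[k] y)), norm_mul, norm_inv,
        Complex.norm_natCast, ← hωψ, ← hωψ]
      gcongr
      linarith [norm_sub_le (ω n n y) (ω n 0 y), (hω n n).norm_apply_le y,
        (hω n 0).norm_apply_le y]
    exact sub_eq_zero.mp
      (tendsto_nhds_unique ((hξ (X.map y)).sub (hξ y)) (h1.mono_left hU))
  have hlim := hξ x
  rw [hX ξ hstate hinv] at hlim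
  exact hlim.congr fun n => havg n x

/-- Strict weak mixing forces unique ergodicity: at an invariant state the sequence of deviations
is constant. -/
theorem StrictlyWeakMixing.uniquelyErgodic {X : CStarSystem A} (hX : X.StrictlyWeakMixing) :
    X.UniquelyErgodic := fun ω hω hinv => by
  ext x
  have h1 : ∀ k, ω (X.map^[k] x) = ω x := fun k => by
    induction k with
    | zero => rfl
    | succ k ih => rw [Function.iterate_succ_apply', hinv, ih]
  have h2 := hX x ω
  simp only [h1, hω.2, one_mul] at h2
  exact sub_eq_zero.mp (CesaroNull.eq_zero_of_const h2)

end Averages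

/-! ### Unique ergodicity of the square -/

section Square

variable {A : Type u} [CStarAlgebra A] [PartialOrder A] [StarOrderedRing A]
  {B : Type v} [CStarAlgebra B] [PartialOrder B] [StarOrderedRing B]

theorem tensor_iterate_tmul (X : CStarSystem A) (Y : CStarSystem B) (k : ℕ) (a : A) (b : B) :
    (X.tensor Y).map^[k] (MinTensor.tmul a b) = MinTensor.tmul (X.map^[k] a) (Y.map^[k] b) := by
  induction k generalizing a b with
  | zero => rfl
  | succ k ih => simp only [Function.iterate_succ_apply, tensor_map_tmul, ih]

theorem iterate_sub_smul_one (X : CStarSystem A) (k : ℕ) (x : A) (c : ℂ) :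
    X.map^[k] (x - c • 1) = X.map^[k] x - c • 1 := by
  induction k generalizing x with
  | zero => rfl
  | succ k ih => rw [Function.iterate_succ_apply, map_sub, map_smul, X.map_one, ih,
      Function.iterate_succ_apply]

/-- Pairing `y ⊗ y*` with a product state gives the mean square of `ψ (T^k y)`. -/
theorem tendsto_average_sq {X : CStarSystem A} (hX : (X.tensor X).UniquelyErgodic)
    {ψ : ℕ → StrongDual ℂ A} (hψ : ∀ n, IsState (ψ n)) {y : A} (hy : X.state y = 0) :
    Filter.Tendsto (fun n : ℕ => (1 / (n : ℝ)) *
      ∑ k ∈ Finset.range n, ‖ψ n (X.map^[k] y)‖ ^ 2) Filter.atTop (nhds 0) := by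
  have h := hX.tendsto_average (ψ := fun n => MinTensor.prodState (ψ n) (ψ n) (hψ n) (hψ n))
    (fun n => MinTensor.isState_prodState _ _ _ _) (MinTensor.tmul y (star y))
  rw [tensor_state_tmul, hy, zero_mul] at h
  have h1 : ∀ n k, MinTensor.prodState (ψ n) (ψ n) (hψ n) (hψ n)
      ((X.tensor X).map^[k] (MinTensor.tmul y (star y))) =
        ((‖ψ n (X.map^[k] y)‖ ^ 2 : ℝ) : ℂ) := fun n k => by
    obtain ⟨ω, hω, hk⟩ := (hψ n).exists_comp_iterate X.map_one k
    rw [tensor_iterate_tmul, MinTensor.prodState_tmul, ← hk, ← hk, hω.apply_star,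
      Complex.ofReal_pow]
    exact Complex.mul_conj' _
  simp only [h1] at h
  have h2 := (Complex.continuous_re.tendsto 0).comp h
  rw [Complex.zero_re] at h2
  refine h2.congr fun n => ?_
  rw [Function.comp_apply, ← Complex.ofReal_sum, ← Complex.ofReal_natCast, ← Complex.ofReal_inv,
    ← Complex.ofReal_mul, Complex.ofReal_re, one_div]

/-- The average of a finite family is at most its root mean square. -/
theorem average_le_sqrt_average_sq (a : ℕ → ℝ) (n : ℕ) :
    (1 / (n : ℝ)) * ∑ k ∈ Finset.range n, a k ≤
      √((1 / (n : ℝ)) * ∑ k ∈ Finset.range n, a k ^ 2) := by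
  refine Real.le_sqrt_of_sq_le ?_
  have h := sq_sum_le_card_mul_sum_sq (s := Finset.range n) (f := a)
  rw [Finset.card_range] at h
  rcases n.eq_zero_or_pos with rfl | hn
  · simp
  · rw [mul_pow]
    calc (1 / (n : ℝ)) ^ 2 * (∑ k ∈ Finset.range n, a k) ^ 2
        ≤ (1 / (n : ℝ)) ^ 2 * (n * ∑ k ∈ Finset.range n, a k ^ 2) := by gcongr
      _ = (1 / (n : ℝ)) * ∑ k ∈ Finset.range n, a k ^ 2 := by field_simp

/-- For an arbitrary functional `ψ`, the sum of `|ψ (T^k y)|` is the value of `ψ` at a unimodular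
combination of the `T^k y`. A state almost norming that combination bounds it. -/
theorem exists_isState_average_le (X : CStarSystem A) (ψ : StrongDual ℂ A) (y : A) (n : ℕ) :
    ∃ φ : StrongDual ℂ A, IsState φ ∧
      (1 / (n : ℝ)) * ∑ k ∈ Finset.range n, ‖ψ (X.map^[k] y)‖ ≤
        3 * ‖ψ‖ * ((1 / (n : ℝ)) * ∑ k ∈ Finset.range n, ‖φ (X.map^[k] y)‖) := by
  have := X.nontrivial
  have hc : ∀ k, ∃ c : ℂ, ‖c‖ ≤ 1 ∧ c * ψ (X.map^[k] y) = ‖ψ (X.map^[k] y)‖ := fun k => by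
    refine ⟨star (ψ (X.map^[k] y)) / ‖ψ (X.map^[k] y)‖, ?_, ?_⟩
    · rw [norm_div, norm_star, Complex.norm_real, norm_norm]
      exact div_self_le_one _
    · rw [div_mul_eq_mul_div, Complex.star_def, Complex.conj_mul']
      rcases eq_or_ne (ψ (X.map^[k] y)) 0 with h | h
      · simp [h]
      · have : (‖ψ (X.map^[k] y)‖ : ℂ) ≠ 0 := by simpa using h
        field_simp
  choose c hc1 hc2 using hc
  obtain ⟨φ, hφ, hd⟩ := exists_isState_norm_le (∑ k ∈ Finset.range n, c k • X.map^[k] y)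
  refine ⟨φ, hφ, ?_⟩
  have h1 : ‖ψ (∑ k ∈ Finset.range n, c k • X.map^[k] y)‖ =
      ∑ k ∈ Finset.range n, ‖ψ (X.map^[k] y)‖ := by
    simp only [map_sum, map_smul, smul_eq_mul, hc2]
    rw [← Complex.ofReal_sum, Complex.norm_real, Real.norm_of_nonneg (by positivity)]
  have h2 : ‖φ (∑ k ∈ Finset.range n, c k • X.map^[k] y)‖ ≤
      ∑ k ∈ Finset.range n, ‖φ (X.map^[k] y)‖ := by
    rw [map_sum]
    refine norm_sum_le_of_le _ fun k _ => ?_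
    rw [map_smul, norm_smul]
    exact mul_le_of_le_one_left (norm_nonneg _) (hc1 k)
  rw [mul_left_comm, ← h1]
  gcongr
  refine (ψ.le_opNorm _).trans ?_
  rw [mul_comm 3, mul_assoc]
  gcongr
  exact hd.trans (by gcongr)

theorem strictlyWeakMixing_of_uniquelyErgodic_tensor {X : CStarSystem A}
    (hX : (X.tensor X).UniquelyErgodic) : X.StrictlyWeakMixing := fun x ψ => by
  let y : A := x - X.state x • 1
  have hy : X.state y = 0 := by simp [y, X.isState.2]
  have hdev : ∀ k, ψ (X.map^[k] x) - ψ 1 * X.state x = ψ (X.map^[k] y) := fun k => by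
    rw [iterate_sub_smul_one, map_sub, map_smul, smul_eq_mul, mul_comm]
  simp only [hdev]
  choose φ hφ hle using X.exists_isState_average_le ψ y
  have h := ((tendsto_average_sq hX hφ hy).sqrt).const_mul (3 * ‖ψ‖)
  rw [Real.sqrt_zero, mul_zero] at h
  refine squeeze_zero (CesaroNull.average_nonneg _) (fun n => (hle n).trans ?_) h
  gcongr
  exact average_le_sqrt_average_sq _ n

end Square

/-! ### Strict weak mixing of tensor products -/

section Tensor

variable {A : Type u} [CStarAlgebra A] [PartialOrder A] [StarOrderedRing A]
  {B : Type v} [CStarAlgebra B] [PartialOrder B] [StarOrderedRing B]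

/-- The deviation from the mean, `ψ (T^k x) - ψ 1 φ x`, as a bilinear map in `ψ` and `x`. -/
noncomputable def deviation (X : CStarSystem A) (k : ℕ) : StrongDual ℂ A →ₗ[ℂ] A →ₗ[ℂ] ℂ :=
  LinearMap.mk₂ ℂ (fun ψ x => ψ ((X.map.toLinearMap ^ k) x) - ψ 1 * X.state x)
    (fun ψ ψ' x => by simp only [add_apply]; ring)
    (fun c ψ x => by simp only [smul_apply, smul_eq_mul]; ring)
    (fun ψ x x' => by simp only [map_add]; ring)
    (fun c ψ x => by simp only [map_smul, smul_eq_mul]; ring)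

theorem deviation_apply (X : CStarSystem A) (k : ℕ) (ψ : StrongDual ℂ A) (x : A) :
    X.deviation k ψ x = ψ (X.map^[k] x) - ψ 1 * X.state x := by
  change ψ ((X.map.toLinearMap ^ k) x) - _ = _
  rw [Module.End.pow_apply]
  rfl

theorem norm_deviation_le (X : CStarSystem A) (k : ℕ) (ψ : StrongDual ℂ A) (x : A) :
    ‖X.deviation k ψ x‖ ≤ (3 + ‖(1 : A)‖) * ‖ψ‖ * ‖x‖ := by
  rw [deviation_apply]
  refine (norm_sub_le _ _).trans ?_
  have h1 : ‖ψ (X.map^[k] x)‖ ≤ ‖ψ‖ * (3 * ‖x‖) :=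
    (ψ.le_opNorm _).trans (by gcongr; exact X.norm_iterate_le k x)
  have h2 : ‖ψ 1 * X.state x‖ ≤ ‖ψ‖ * ‖(1 : A)‖ * ‖x‖ := by
    rw [norm_mul]
    gcongr
    · exact ψ.le_opNorm 1
    · exact X.isState.norm_apply_le x
  linarith

/-- A functional that restricts to a product functional on elementary tensors satisfies the mixing
condition on elementary tensors. -/
theorem StrictlyWeakMixing.cesaroNull_tmul {X : CStarSystem A} {Y : CStarSystem B}
    (hX : X.StrictlyWeakMixing) (hY : Y.StrictlyWeakMixing) {ω : StrongDual ℂ (MinTensor A B)}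
    {f : StrongDual ℂ A} {g : StrongDual ℂ B}
    (hω : ∀ a b, ω (MinTensor.tmul a b) = f a * g b) (a : A) (b : B) :
    CesaroNull fun k => (X.tensor Y).deviation k ω (MinTensor.tmul a b) := by
  have h1 : CesaroNull fun k => X.deviation k f a * g (Y.map^[k] b) := by
    refine CesaroNull.of_norm_le (hX a f) (‖g‖ * (3 * ‖b‖)) fun k => ?_
    rw [norm_mul, mul_comm, deviation_apply]
    gcongr
    exact (g.le_opNorm _).trans (by gcongr; exact Y.norm_iterate_le k b)
  have h2 : CesaroNull fun k => f 1 * X.state a * Y.deviation k g b :=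
    CesaroNull.of_norm_le (hY b g) ‖f 1 * X.state a‖ fun k => by
      rw [norm_mul, deviation_apply]
  convert h1.add h2 using 2 with k
  have hone : ω 1 = f 1 * g 1 := by
    rw [← hω]
    exact congrArg ω (_root_.map_one (MinTensor.emb : A ⊗[ℂ] B →⋆ₐ[ℂ] MinTensor A B)).symm
  simp only [Pi.add_apply, deviation_apply, tensor_iterate_tmul, tensor_state_tmul, hω, hone]
  ring

/-- If product functionals span a norm dense subspace of the dual, strict weak mixing passes to
tensor products, by bilinearity and density in both the functional and the element. -/
theorem StrictlyWeakMixing.tensor {X : CStarSystem A} {Y : CStarSystem B}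
    (hX : X.StrictlyWeakMixing) (hY : Y.StrictlyWeakMixing) (hd : DualTensorDense A B) :
    (X.tensor Y).StrictlyWeakMixing := by
  have hprod : ∀ (ω : StrongDual ℂ (MinTensor A B)) (f : StrongDual ℂ A) (g : StrongDual ℂ B),
      (∀ a b, ω (MinTensor.tmul a b) = f a * g b) → ∀ x,
        x ∈ CesaroNull.submodule fun k => (X.tensor Y).deviation k ω := by
    intro ω f g hω x
    refine MinTensor.denseRange_emb.induction_on x
      (CesaroNull.isClosed_submodule fun k v => (X.tensor Y).norm_deviation_le k ω v) fun t => ?_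
    induction t with
    | zero => rw [map_zero]; exact Submodule.zero_mem _
    | add s t hs ht => rw [map_add]; exact Submodule.add_mem _ hs ht
    | tmul a b => exact hX.cesaroNull_tmul hY hω a b
  intro x ψ
  have hle : (Submodule.span ℂ {ω : StrongDual ℂ (MinTensor A B) |
      ∃ (f : StrongDual ℂ A) (g : StrongDual ℂ B),
        ∀ a b, ω (MinTensor.tmul a b) = f a * g b}).topologicalClosure ≤
      CesaroNull.submodule fun k => ((X.tensor Y).deviation k).flip x := by
    refine Submodule.topologicalClosure_minimal _ (Submodule.span_le.mpr ?_)
      (CesaroNull.isClosed_submodule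
        (C := (3 + ‖(1 : MinTensor A B)‖) * ‖x‖) fun k ω => ?_)
    · rintro ω ⟨f, g, hω⟩
      exact hprod ω f g hω x
    · rw [mul_right_comm]
      exact (X.tensor Y).norm_deviation_le k ω x
  have hψ := hle (hd ▸ Submodule.mem_top : ψ ∈ _)
  simpa only [CesaroNull.mem_submodule, CesaroNull, LinearMap.flip_apply, deviation_apply] using hψ

end Tensor

end CStarSystem

theorem mainTheorem2 {A : Type u} [CStarAlgebra A] [PartialOrder A] [StarOrderedRing A]
    (X : CStarSystem A) :
    ((X.tensor X).UniquelyErgodic → X.StrictlyWeakMixing) ∧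
    (DualTensorDense A A →
      List.TFAE [(X.tensor X).UniquelyErgodic, X.StrictlyWeakMixing,
        (X.tensor X).StrictlyWeakMixing]) := by
  refine ⟨CStarSystem.strictlyWeakMixing_of_uniquelyErgodic_tensor, fun hd => ?_⟩
  tfae_have 1 → 2 := CStarSystem.strictlyWeakMixing_of_uniquelyErgodic_tensor
  tfae_have 2 → 3 := fun h => h.tensor h hd
  tfae_have 3 → 1 := fun h => h.uniquelyErgodic
  tfae_finish
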